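/- Let $\mathbb{H}$ be the upper half plane, $q=e^{2\pi i\tau}$, and let $\eta(\tau)=e^{2\pi i\tau/24}\prod_{k\ge 1}(1-q^k)$ be the Dedekind eta function. For $\tau\in\mathbb{H}$ put $$x(\tau)=\frac{\eta(2\tau)\,\eta(10\tau)^3}{\eta(\tau)^3\,\eta(5\tau)},\qquad y(\tau)=\frac{\eta(2\tau)^2\,\eta(4\tau)\,\eta(5\tau)\,\eta(20\tau)^3}{\eta(\tau)^5\,\eta(10\tau)^2},$$ and let $W=\begin{pmatrix}4&-1\\100&-24\end{pmatrix}$ act on $\mathbb{H}$ by $W\tau=\frac{4\tau-1}{100\tau-24}$. **Theorem.** The function $1+5x$ has no zero in $\mathbb{H}$. Let $j\in\{0,1\}$, let $m,n\ge 0$ be integers, and let $f=y^j\,\dfrac{x^m}{(1+5x)^n}$. Then for every $\tau\in\mathbb{H}$, $$f(W\tau)=(-1)^{m+n}\,4^{\,n-2j-m}\,\frac{(1+4x)^j\,(1+10x+20y)^j\,(1+10x+20x^2+4y)^m\,(1+5x+5y)^n}{(1+5x)^{3j+2m+n}},$$ where $x$ and $y$ on the right-hand side are evaluated at $\tau$.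 -/

import Mathlib

namespace LevelTwenty

open UpperHalfPlane ModularForm

/-- The eta quotient `x = η(2τ) η(10τ)³ / (η(τ)³ η(5τ))` on the upper half plane,
where `η` is the Dedekind eta function. -/
noncomputable def x (τ : ℍ) : ℂ :=
  eta (2 * (τ : ℂ)) * eta (10 * (τ : ℂ)) ^ 3 / (eta (τ : ℂ) ^ 3 * eta (5 * (τ : ℂ)))

/-- The eta quotient `y = η(2τ)² η(4τ) η(5τ) η(20τ)³ / (η(τ)⁵ η(10τ)²)`
on the upper half plane. -/
noncomputable def y (τ : ℍ) : ℂ :=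
  eta (2 * (τ : ℂ)) ^ 2 * eta (4 * (τ : ℂ)) * eta (5 * (τ : ℂ)) * eta (20 * (τ : ℂ)) ^ 3 /
    (eta (τ : ℂ) ^ 5 * eta (10 * (τ : ℂ)) ^ 2)

/-- The matrix `W` of determinant `4`; it acts on the upper half plane through Mathlib's
Möbius action of `GL (Fin 2) ℝ`. -/
noncomputable def W : GL (Fin 2) ℝ :=
  Matrix.GeneralLinearGroup.mkOfDetNeZero !![4, -1; 100, -24] (by norm_num [Matrix.det_fin_two])

/-- The action of `W` is the expected fractional linear transformation. -/
theorem coe_W_smul (τ : ℍ) :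
    ((W • τ : ℍ) : ℂ) = (4 * (τ : ℂ) - 1) / (100 * (τ : ℂ) - 24) := by
  have hdet : (0 : ℝ) < W.det.val := by
    norm_num [W, Matrix.GeneralLinearGroup.mkOfDetNeZero, Matrix.det_fin_two]
  rw [UpperHalfPlane.coe_smul_of_det_pos hdet]
  simp [UpperHalfPlane.num, UpperHalfPlane.denom, W,
    Matrix.GeneralLinearGroup.mkOfDetNeZero, sub_eq_add_neg]

/-- The function `y^j x^m / (1 + 5x)^n` on the upper half plane. -/
noncomputable def f (j m n : ℕ) (τ : ℍ) : ℂ :=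
  y τ ^ j * (x τ ^ m / (1 + 5 * x τ) ^ n)

end LevelTwenty

/-! Put X = x(τ) and t = x(2τ). Comparing eta factors gives y = (1 + 5X)t (`y_eq`), so the theorem
reduces to three facts about x, a Hauptmodul of level ten.

Both 1 + 4x and 1 + 5x are eta quotients (`one_add_four_mul_hauptmodul`,
`one_add_five_mul_hauptmodul`); in particular 1 + 5x has no zero. They come from two theta
identities: the square of a theta series is a sum over the Gaussian integers, which is split modulo
2 + i and evaluated by the Jacobi triple product.

The functions X and t satisfy a quadratic relation (`hauptmodul_sq`), found by eliminating x(-q)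
from two product formulas.

Two Atkin-Lehner maps w satisfy 1 + 4x(w) = x/(1 + 5x), by the transformation law of eta squared.
One sends 2τ to Wτ and the other sends τ to 2Wτ, so x(Wτ) and y(Wτ) are rational in X and t. The
quadratic relation turns these into the stated expressions in x and y. -/

namespace LevelTwenty

open Filter Topology Finset Complex

/-! ### The q-binomial theorem and the Jacobi triple product. -/

/-- The infinite `q`-Pochhammer symbol `(a; p)_∞`. -/
noncomputable def qPoch (a p : ℂ) : ℂ := ∏' k : ℕ, (1 - a * p ^ k)

theorem summable_norm_qPoch (a : ℂ) {p : ℂ} (hp : ‖p‖ < 1) :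
    Summable fun k : ℕ => ‖-(a * p ^ k)‖ := by
  simpa [norm_mul, norm_pow] using
    (summable_geometric_of_lt_one (norm_nonneg p) hp).mul_left ‖a‖

theorem multipliable_qPoch (a : ℂ) {p : ℂ} (hp : ‖p‖ < 1) :
    Multipliable fun k : ℕ => 1 - a * p ^ k := by
  simpa [sub_eq_add_neg] using multipliable_one_add_of_summable (summable_norm_qPoch a hp)

theorem tendsto_qPoch (a : ℂ) {p : ℂ} (hp : ‖p‖ < 1) :
    Tendsto (fun N => ∏ k ∈ range N, (1 - a * p ^ k)) atTop (𝓝 (qPoch a p)) :=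
  (multipliable_qPoch a hp).hasProd.tendsto_prod_nat

theorem qPoch_ne_zero {a p : ℂ} (hp : ‖p‖ < 1) (h : ∀ k : ℕ, 1 - a * p ^ k ≠ 0) :
    qPoch a p ≠ 0 := by
  have := tprod_one_add_ne_zero_of_summable (f := fun k : ℕ => -(a * p ^ k))
    (fun k => by simpa [sub_eq_add_neg] using h k) (summable_norm_qPoch a hp)
  simpa [qPoch, sub_eq_add_neg] using this

/-- Gaussian binomial coefficients evaluated at `p`. -/
noncomputable def gaussBinom (p : ℂ) : ℕ → ℕ → ℂ
  | _, 0 => 1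
  | 0, _ + 1 => 0
  | M + 1, j + 1 => gaussBinom p M j + p ^ (j + 1) * gaussBinom p M (j + 1)

theorem gaussBinom_zero_right (p : ℂ) (M : ℕ) : gaussBinom p M 0 = 1 := by
  cases M <;> simp [gaussBinom]

theorem gaussBinom_eq_zero (p : ℂ) {M j : ℕ} (h : M < j) : gaussBinom p M j = 0 := by
  induction M generalizing j with
  | zero => obtain ⟨j, rfl⟩ := Nat.exists_eq_add_of_lt h; simp [gaussBinom]
  | succ M ih =>
    obtain ⟨j, rfl⟩ : ∃ i, j = i + 1 := ⟨j - 1, by omega⟩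
    simp [gaussBinom, ih (show M < j by omega), ih (show M < j + 1 by omega)]

/-- The factorial formula for Gaussian binomials, free of division; it follows from the q-Pascal
rule by double induction and yields both the limit and the uniform bound below. -/
theorem gaussBinom_mul (p : ℂ) (M j : ℕ) :
    gaussBinom p (M + j) j * (∏ k ∈ range j, (1 - p * p ^ k)) *
      (∏ k ∈ range M, (1 - p * p ^ k)) = ∏ k ∈ range (M + j), (1 - p * p ^ k) := by
  induction M generalizing j with
  | zero =>
    induction j with
    | zero => simp [gaussBinom]
    | succ j ih =>
      simp only [zero_add, prod_range_zero, mul_one] at ih ⊢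
      rw [gaussBinom, gaussBinom_eq_zero p (Nat.lt_succ_self j), prod_range_succ]
      linear_combination (1 - p * p ^ j) * ih
  | succ M ihM =>
    induction j with
    | zero => simp [gaussBinom]
    | succ j ih =>
      have h := ihM (j + 1)
      rw [show M + 1 + (j + 1) = (M + 1 + j) + 1 by ring, gaussBinom, prod_range_succ,
        prod_range_succ _ M, prod_range_succ _ (M + 1 + j)] 
      rw [prod_range_succ _ M] at ih
      rw [show M + (j + 1) = M + 1 + j by ring, prod_range_succ] at h
      rw [← h] at ih ⊢
      have : p ^ (M + 1 + j) = p ^ M * p * p ^ j := by ring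
      rw [this, pow_succ]
      linear_combination (1 - p * p ^ j) * ih

/-- The q-Pascal rule followed by an index shift. Both finite product formulas below use it as their
induction step. -/
theorem sum_gaussBinom_succ (p : ℂ) (F : ℕ → ℂ) (M : ℕ) :
    ∑ j ∈ range (M + 2), gaussBinom p (M + 1) j * F j =
      ∑ j ∈ range (M + 1), gaussBinom p M j * (p ^ j * F j + F (j + 1)) := by
  have h : ∑ j ∈ range (M + 1), gaussBinom p M j * (p ^ j * F j) =
      ∑ j ∈ range (M + 1), gaussBinom p M (j + 1) * (p ^ (j + 1) * F (j + 1)) + F 0 := by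
    have h1 := sum_range_succ' (fun j => gaussBinom p M j * (p ^ j * F j)) (M + 1)
    have h2 := sum_range_succ (fun j => gaussBinom p M j * (p ^ j * F j)) (M + 1)
    rw [gaussBinom_eq_zero p (Nat.lt_succ_self M)] at h2
    simp only [gaussBinom_zero_right, pow_zero, one_mul] at h1
    rw [← h1, h2]; ring
  rw [sum_range_succ']
  simp only [mul_add, sum_add_distrib, h, gaussBinom, add_mul]
  rw [one_mul, add_comm (∑ j ∈ range (M + 1), gaussBinom p M j * F (j + 1)), add_right_comm]
  congr 2
  exact sum_congr rfl fun j _ => by ring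

/-- Rothe's identity. -/
theorem prod_one_add_mul_pow (p : ℂ) (N : ℕ) (a : ℂ) (F : ℕ → ℂ)
    (hF : ∀ j, F (j + 1) = a * p ^ j * F j) :
    (∏ k ∈ range N, (1 + a * p ^ k)) * F 0 =
      ∑ j ∈ range (N + 1), gaussBinom p N j * F j := by
  induction N generalizing a F with
  | zero => simp [gaussBinom]
  | succ N ih =>
    -- Peeling off the factor k = 0 replaces a by a * p, and the weights p ^ j absorb the change in
    -- the recursion for F.
    have h := ih (a * p) (fun j => p ^ j * F j) fun j => by rw [hF]; ring
    rw [sum_gaussBinom_succ, prod_range_succ']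
    simp only [pow_zero, one_mul, mul_one] at h ⊢
    have h2 : ∏ k ∈ range N, (1 + a * p ^ (k + 1)) = ∏ k ∈ range N, (1 + a * p * p ^ k) :=
      prod_congr rfl fun k _ => by ring
    rw [h2, mul_right_comm, h, sum_mul]
    exact sum_congr rfl fun j _ => by rw [hF]; ring

/-- Each new factor 1 + b p^m moves the window of T one place to the left, because a b = p gives b
p^m T(j - m) = p^j T(j - m - 1). -/
theorem finite_triple_product {p a b : ℂ} (hp : p ≠ 0) (hab : a * b = p) (T : ℤ → ℂ)
    (hT : ∀ n, T (n + 1) = a * p ^ n * T n) (m N : ℕ) :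
    (∏ k ∈ range m, (1 + b * p ^ k)) * (∏ k ∈ range N, (1 + a * p ^ k)) * T 0 =
      ∑ j ∈ range (m + N + 1), gaussBinom p (m + N) j * T (j - m) := by
  induction m with
  | zero =>
    have := prod_one_add_mul_pow p N a (fun j => T j) fun j => by
      have := hT j
      simpa using this
    simpa using this
  | succ m ih =>
    rw [prod_range_succ, show m + 1 + N = m + N + 1 by ring, sum_gaussBinom_succ,
      mul_right_comm _ (1 + b * p ^ m), mul_right_comm _ (1 + b * p ^ m), ih, sum_mul]
    refine sum_congr rfl fun j _ => ?_
    have h := hT (j - (m + 1))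
    rw [show (j : ℤ) - (m + 1) + 1 = j - m by ring] at h
    have h3 : p ^ ((j : ℤ) - (m + 1)) * p ^ (m + 1) = p ^ j := by
      rw [← zpow_natCast, ← zpow_add₀ hp, ← zpow_natCast]; congr 1; push_cast; ring
    push_cast
    rw [show (j : ℤ) + 1 - (m + 1) = j - m by ring]
    have h4 : b * p ^ m * T (j - m) = p ^ j * T (j - (m + 1)) := by
      rw [h, ← h3, pow_succ]
      linear_combination p ^ m * p ^ ((j : ℤ) - (m + 1)) * T (j - (m + 1)) * hab
    linear_combination gaussBinom p (m + N) j * h4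

theorem one_sub_mul_pow_ne_zero {p : ℂ} (hp : ‖p‖ < 1) (k : ℕ) : 1 - p * p ^ k ≠ 0 := by
  intro h
  have : ‖p ^ (k + 1)‖ = 1 := by rw [pow_succ', ← sub_eq_zero.mp h, norm_one]
  rw [norm_pow] at this
  exact absurd this (pow_lt_one₀ (norm_nonneg _) hp (by omega)).ne

/-- For N ≥ |n| the coefficient is (p)_{2N} / ((p)_{N+n} (p)_{N-n}), and all three products tend to
the same nonzero limit. The truncation in `toNat` only affects smaller N. -/
theorem tendsto_gaussBinom {p : ℂ} (hp : ‖p‖ < 1) (n : ℤ) :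
    Tendsto (fun N : ℕ => gaussBinom p (N + N) (n + N).toNat) atTop (𝓝 (qPoch p p)⁻¹) := by
  have h0 := qPoch_ne_zero hp (one_sub_mul_pow_ne_zero hp)
  have hP := tendsto_qPoch p hp
  have t1 : Tendsto (fun N : ℕ => (n + N).toNat) atTop atTop :=
    tendsto_atTop.2 fun b => (eventually_ge_atTop (b + n.natAbs)).mono fun N hN => by omega
  have t2 : Tendsto (fun N : ℕ => ((N : ℤ) - n).toNat) atTop atTop :=
    tendsto_atTop.2 fun b => (eventually_ge_atTop (b + n.natAbs)).mono fun N hN => by omega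
  have t3 : Tendsto (fun N : ℕ => N + N) atTop atTop :=
    tendsto_atTop.2 fun b => (eventually_ge_atTop b).mono fun N hN => by omega
  have := ((hP.comp t3).div ((hP.comp t1).mul (hP.comp t2)) (mul_ne_zero h0 h0))
  rw [← div_div, div_self h0, one_div] at this
  refine this.congr' ((eventually_ge_atTop n.natAbs).mono fun N hN => ?_)
  have h := gaussBinom_mul p ((N : ℤ) - n).toNat (n + N).toNat
  rw [show ((N : ℤ) - n).toNat + (n + N).toNat = N + N by omega] at h
  have hne : ∀ M, ∏ k ∈ range M, (1 - p * p ^ k) ≠ 0 := fun M =>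
    prod_ne_zero_iff.2 fun k _ => one_sub_mul_pow_ne_zero hp k
  simp only [Function.comp, Pi.div_apply]
  rw [div_eq_iff (mul_ne_zero (hne _) (hne _)), ← h]
  ring

/-- The partial products and their inverses converge, hence are bounded. This supplies the
dominating series in the triple product. -/
theorem exists_norm_gaussBinom_le {p : ℂ} (hp : ‖p‖ < 1) :
    ∃ C, ∀ M j, ‖gaussBinom p M j‖ ≤ C := by
  have h0 := qPoch_ne_zero hp (one_sub_mul_pow_ne_zero hp)
  have hP := tendsto_qPoch p hp
  obtain ⟨A, hA⟩ := (Metric.isBounded_range_of_tendsto _ hP).exists_norm_le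
  obtain ⟨B, hB⟩ := (Metric.isBounded_range_of_tendsto _ (hP.inv₀ h0)).exists_norm_le
  have hA' := fun N => hA _ (Set.mem_range_self N)
  have hB' := fun N => hB _ (Set.mem_range_self N)
  have hA0 : 0 ≤ A := (norm_nonneg _).trans (hA' 0)
  have hB0 : 0 ≤ B := (norm_nonneg _).trans (hB' 0)
  have hne : ∀ M, ∏ k ∈ range M, (1 - p * p ^ k) ≠ 0 := fun M =>
    prod_ne_zero_iff.2 fun k _ => one_sub_mul_pow_ne_zero hp k
  refine ⟨A * B * B, fun M j => ?_⟩
  rcases lt_or_ge M j with h | h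
  · rw [gaussBinom_eq_zero p h, norm_zero]; positivity
  · obtain ⟨i, rfl⟩ := Nat.exists_eq_add_of_le' h
    have h1 := gaussBinom_mul p i j
    have h2 : gaussBinom p (i + j) j = (∏ k ∈ range (i + j), (1 - p * p ^ k)) *
        (∏ k ∈ range j, (1 - p * p ^ k))⁻¹ * (∏ k ∈ range i, (1 - p * p ^ k))⁻¹ := by
      rw [← h1]
      have := hne i
      have := hne j
      field_simp
    rw [h2, norm_mul, norm_mul]
    gcongr
    · exact hA' _
    · exact hB' _
    · exact hB' _

/-- The Jacobi triple product. -/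
theorem tsum_eq_triple_product {p a b : ℂ} (hp0 : p ≠ 0) (hp : ‖p‖ < 1) (hab : a * b = p)
    (T : ℤ → ℂ) (hT : ∀ n, T (n + 1) = a * p ^ n * T n) (hT0 : T 0 = 1) (hs : Summable T) :
    ∑' n, T n = qPoch p p * qPoch (-a) p * qPoch (-b) p := by
  have h0 := qPoch_ne_zero hp (one_sub_mul_pow_ne_zero hp)
  obtain ⟨C, hC⟩ := exists_norm_gaussBinom_le hp
  let h : ℕ → ℤ → ℂ := fun N n =>
    if n ∈ Icc (-(N : ℤ)) N then gaussBinom p (N + N) (n + N).toNat * T n else 0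
  have hsum : ∀ N, ∑' n, h N n =
      (∏ k ∈ range N, (1 - -b * p ^ k)) * (∏ k ∈ range N, (1 - -a * p ^ k)) := by
    intro N
    have := finite_triple_product hp0 hab T hT N N
    rw [hT0, mul_one] at this
    simp only [neg_mul, sub_neg_eq_add]
    rw [this, tsum_eq_sum (s := Icc (-(N : ℤ)) N) (fun n hn => if_neg hn)]
    refine sum_nbij' (fun n => (n + N).toNat) (fun j => (j : ℤ) - N) ?_ ?_ ?_ ?_ ?_
    · intro n hn; simp only [mem_Icc, mem_range] at hn ⊢; omega
    · intro n hn; simp only [mem_Icc, mem_range] at hn ⊢; omega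
    · intro n hn; simp only [mem_Icc] at hn ⊢; omega
    · intro n hn; simp only [mem_range] at hn ⊢; omega
    · intro n hn
      have h1 : (((n + N).toNat : ℤ)) - N = n := by simp only [mem_Icc] at hn; omega
      simp only [if_pos hn, h1]
  have hlim : Tendsto (fun N => ∑' n, h N n) atTop (𝓝 (∑' n, (qPoch p p)⁻¹ * T n)) := by
    refine tendsto_tsum_of_dominated_convergence (bound := fun n => C * ‖T n‖)
      (hs.norm.mul_left C) (fun n => ?_) (Eventually.of_forall fun N n => ?_)
    · refine ((tendsto_gaussBinom hp n).mul_const (T n)).congr'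
        ((eventually_ge_atTop n.natAbs).mono fun N hN => ?_)
      exact (if_pos (by simp only [mem_Icc]; omega)).symm
    · simp only [h]
      split_ifs
      · rw [norm_mul]; exact mul_le_mul_of_nonneg_right (hC _ _) (norm_nonneg _)
      · rw [norm_zero]
        exact mul_nonneg ((norm_nonneg _).trans (hC 0 0)) (norm_nonneg _)
  have hlim2 := (tendsto_qPoch (-b) hp).mul (tendsto_qPoch (-a) hp)
  have := tendsto_nhds_unique hlim (hlim2.congr fun N => (hsum N).symm)
  rw [tsum_mul_left] at this
  rw [mul_assoc, mul_comm (qPoch (-a) p), ← this, mul_inv_cancel_left₀ h0]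

/-- The Jacobi triple product for Mathlib's two-variable theta function. -/
theorem jacobiTheta₂_eq_qPoch {z τ a b p : ℂ} (hτ : 0 < τ.im)
    (ha : cexp (2 * Real.pi * I * z + Real.pi * I * τ) = a)
    (hb : cexp (-(2 * Real.pi * I * z) + Real.pi * I * τ) = b)
    (hpp : a * b = p) :
    jacobiTheta₂ z τ = qPoch p p * qPoch (-a) p * qPoch (-b) p := by
  have hp' : p = cexp (2 * Real.pi * I * τ) := by
    rw [← hpp, ← ha, ← hb, ← Complex.exp_add]; congr 1; ring
  refine tsum_eq_triple_product (hp' ▸ Complex.exp_ne_zero _) ?_ hpp _ (fun n => ?_) ?_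
    ((summable_jacobiTheta₂_term_iff z τ).2 hτ)
  · rw [hp', Complex.norm_exp, Real.exp_lt_one_iff]
    simp
    positivity
  · rw [hp', ← ha, jacobiTheta₂_term, jacobiTheta₂_term, ← Complex.exp_int_mul,
      ← Complex.exp_add, ← Complex.exp_add]
    congr 1
    push_cast
    ring
  · simp [jacobiTheta₂_term]

end LevelTwenty

/-! ### Dissections of Euler products. -/

namespace LevelTwenty

open Filter Topology Finset Complex

theorem qPoch_succ (a : ℂ) {p : ℂ} (hp : ‖p‖ < 1) : qPoch a p = (1 - a) * qPoch (a * p) p := by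
  have h1 := (tendsto_qPoch a hp).comp (tendsto_add_atTop_nat 1)
  have h2 := (tendsto_qPoch (a * p) hp).const_mul (1 - a)
  refine tendsto_nhds_unique h1 (h2.congr fun N => ?_)
  simp only [Function.comp, prod_range_succ', pow_zero, mul_one]
  rw [mul_comm]
  congr 1
  exact prod_congr rfl fun k _ => by ring

theorem qPoch_mul_neg (a : ℂ) {p : ℂ} (hp : ‖p‖ < 1) :
    qPoch a p * qPoch (-a) p = qPoch (a ^ 2) (p ^ 2) := by
  have hp2 : ‖p ^ 2‖ < 1 := by rw [norm_pow]; exact pow_lt_one₀ (norm_nonneg _) hp two_ne_zero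
  refine tendsto_nhds_unique ((tendsto_qPoch a hp).mul (tendsto_qPoch (-a) hp))
    ((tendsto_qPoch (a ^ 2) hp2).congr fun N => ?_)
  rw [← prod_mul_distrib]
  exact prod_congr rfl fun k _ => by ring

/-- Splitting an infinite product according to residues modulo `n`. -/
theorem qPoch_eq_prod (a : ℂ) {p : ℂ} (hp : ‖p‖ < 1) {n : ℕ} (hn : n ≠ 0) :
    qPoch a p = ∏ i ∈ range n, qPoch (a * p ^ i) (p ^ n) := by
  have hpn : ‖p ^ n‖ < 1 := by rw [norm_pow]; exact pow_lt_one₀ (norm_nonneg _) hp hn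
  have h1 : Tendsto (fun N : ℕ => n * N) atTop atTop :=
    tendsto_id.const_mul_atTop' (Nat.pos_of_ne_zero hn)
  have h2 := tendsto_finsetProd (range n) fun i _ => tendsto_qPoch (a * p ^ i) hpn
  refine tendsto_nhds_unique ((tendsto_qPoch a hp).comp h1) (h2.congr fun N => ?_)
  simp only [Function.comp]
  induction N with
  | zero => simp
  | succ N ih =>
    simp only [prod_range_succ, prod_mul_distrib, mul_add, mul_one, prod_range_add] at ih ⊢
    rw [ih]
    congr 1
    exact prod_congr rfl fun i _ => by ring

theorem qPoch_self_ne_zero {p : ℂ} (hp : ‖p‖ < 1) : qPoch p p ≠ 0 :=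
  qPoch_ne_zero hp (one_sub_mul_pow_ne_zero hp)

theorem norm_pow_lt_one {q : ℂ} (hq : ‖q‖ < 1) {n : ℕ} (hn : n ≠ 0) : ‖q ^ n‖ < 1 := by
  rw [norm_pow]; exact pow_lt_one₀ (norm_nonneg _) hq hn

theorem qPoch_neg_self {q : ℂ} (hq : ‖q‖ < 1) :
    qPoch (-q) q = qPoch (q ^ 2) (q ^ 2) / qPoch q q := by
  rw [eq_div_iff (qPoch_self_ne_zero hq), mul_comm, qPoch_mul_neg q hq]

theorem qPoch_self_sq {q : ℂ} (hq : ‖q‖ < 1) :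
    qPoch q (q ^ 2) = qPoch q q / qPoch (q ^ 2) (q ^ 2) := by
  rw [eq_div_iff (qPoch_self_ne_zero (norm_pow_lt_one hq two_ne_zero)),
    qPoch_eq_prod q hq two_ne_zero]
  simp [prod_range_succ, pow_two]

/-- Euler's product at `-q`. -/
theorem qPoch_neg_neg {q : ℂ} (hq : ‖q‖ < 1) :
    qPoch (-q) (-q) = qPoch (q ^ 2) (q ^ 2) ^ 3 / (qPoch q q * qPoch (q ^ 4) (q ^ 4)) := by
  have hq2 := norm_pow_lt_one hq two_ne_zero
  have hq4 := norm_pow_lt_one hq four_ne_zero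
  have h1 := qPoch_self_ne_zero hq
  have h2 := qPoch_self_ne_zero hq2
  have h4 := qPoch_self_ne_zero hq4
  have h := qPoch_eq_prod (-q) (p := -q) (by rwa [norm_neg]) two_ne_zero
  have h' := qPoch_eq_prod (-q) hq two_ne_zero
  have h'' := qPoch_neg_self hq2
  simp only [prod_range_succ, prod_range_zero, pow_zero, one_mul, pow_one, mul_one, neg_mul,
    mul_neg, neg_neg, neg_sq] at h h'
  rw [← pow_two] at h h'
  rw [← pow_mul] at h''
  rw [qPoch_neg_self hq, h''] at h'
  norm_num at h'
  rw [h]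
  field_simp at h' ⊢
  linear_combination -h'

/-- Split (-q; q)_∞ by exponents modulo 5 and remove the class of multiples of 5. -/
theorem prod_theta_five {q : ℂ} (hq : ‖q‖ < 1) :
    qPoch (-q) (q ^ 5) * qPoch (-q ^ 2) (q ^ 5) * qPoch (-q ^ 3) (q ^ 5) * qPoch (-q ^ 4) (q ^ 5) =
      qPoch (q ^ 2) (q ^ 2) / qPoch q q *
        (qPoch (q ^ 5) (q ^ 5) / qPoch (q ^ 10) (q ^ 10)) := by
  have hq5 := norm_pow_lt_one hq (show 5 ≠ 0 by norm_num)
  have hq10 := norm_pow_lt_one hq (show 10 ≠ 0 by norm_num)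
  have h1 := qPoch_self_ne_zero hq
  have h5 := qPoch_self_ne_zero hq5
  have h10 := qPoch_self_ne_zero hq10
  have h := qPoch_eq_prod (-q) hq (show 5 ≠ 0 by norm_num)
  have h' := qPoch_neg_self hq5
  rw [← pow_mul] at h'
  simp only [prod_range_succ, prod_range_zero, pow_zero, one_mul, pow_one, mul_one, neg_mul] at h
  rw [show q * q = q ^ 2 by ring, show q * q ^ 2 = q ^ 3 by ring, show q * q ^ 3 = q ^ 4 by ring,
    show q * q ^ 4 = q ^ 5 by ring, h', qPoch_neg_self hq] at h
  norm_num at h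
  rw [h]
  field_simp

/-- Split (q; q²)_∞, whose exponents are odd, into the classes 1, 3, 5, 7, 9 modulo 10 and remove
the class 5. -/
theorem prod_theta_ten {q : ℂ} (hq : ‖q‖ < 1) :
    qPoch q (q ^ 10) * qPoch (q ^ 3) (q ^ 10) * qPoch (q ^ 7) (q ^ 10) * qPoch (q ^ 9) (q ^ 10) =
      qPoch q q / qPoch (q ^ 2) (q ^ 2) *
        (qPoch (q ^ 10) (q ^ 10) / qPoch (q ^ 5) (q ^ 5)) := by
  have hq2 := norm_pow_lt_one hq two_ne_zero
  have hq5 := norm_pow_lt_one hq (show 5 ≠ 0 by norm_num)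
  have hq10 := norm_pow_lt_one hq (show 10 ≠ 0 by norm_num)
  have h2 := qPoch_self_ne_zero hq2
  have h5 := qPoch_self_ne_zero hq5
  have h10 := qPoch_self_ne_zero hq10
  have h := qPoch_eq_prod q hq2 (show 5 ≠ 0 by norm_num)
  have h' := qPoch_self_sq hq5
  rw [← pow_mul] at h'
  simp only [prod_range_succ, prod_range_zero, one_mul, mul_one, ← pow_mul] at h
  rw [show q * q ^ 2 = q ^ 3 by ring, show q * q ^ (2 * 2) = q ^ 5 by ring,
    show q * q ^ (2 * 3) = q ^ 7 by ring, show q * q ^ (2 * 4) = q ^ 9 by ring,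
    qPoch_self_sq hq] at h
  norm_num at h h'
  rw [h'] at h
  rw [h]
  field_simp

end LevelTwenty

/-! ### Squares of theta series, split over ℤ[i] modulo 2 + i. -/

namespace LevelTwenty

open Filter Topology Finset Complex

/-- The residue classes of `ℤ[i]` modulo `2 + i`, represented by `0` and the units. -/
def splitGauss : Fin 5 × ℤ × ℤ → ℤ × ℤ
  | (0, a, b) => (2 * a - b, a + 2 * b)
  | (1, a, b) => (1 + 2 * a - b, a + 2 * b)
  | (2, a, b) => (-a - 2 * b, 1 + 2 * a - b)
  | (3, a, b) => (-1 - 2 * a + b, -a - 2 * b)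
  | (4, a, b) => (a + 2 * b, -1 - 2 * a + b)

/-- The residue classes modulo `2 + i` of the Gaussian integers `(2m + 1) + (2n + 1)i`, in the
coordinates `(m, n)`. -/
def splitOddGauss : Fin 5 × ℤ × ℤ → ℤ × ℤ
  | (0, a, b) => (2 * a - b, a + 2 * b + 1)
  | (1, a, b) => (2 * a - b, a + 2 * b)
  | (2, a, b) => (-a - 2 * b - 1, 2 * a - b)
  | (3, a, b) => (-2 * a + b - 1, -a - 2 * b - 1)
  | (4, a, b) => (a + 2 * b, -2 * a + b - 1)

theorem splitGauss_bijective : Function.Bijective splitGauss := by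
  constructor
  · rintro ⟨c, a, b⟩ ⟨c', a', b'⟩ h
    fin_cases c <;> fin_cases c' <;> simp [splitGauss, Prod.ext_iff] at h ⊢ <;> omega
  · rintro ⟨m, n⟩
    -- Since i ≡ -2 modulo 2 + i, the class of m + ni is m - 2n modulo 5.
    have h : (m - 2 * n) % 5 = 0 ∨ (m - 2 * n) % 5 = 1 ∨ (m - 2 * n) % 5 = 2 ∨
      (m - 2 * n) % 5 = 3 ∨ (m - 2 * n) % 5 = 4 := by omega
    rcases h with h | h | h | h | h
    · exact ⟨(0, (2 * m + n) / 5, (2 * n - m) / 5), by simp only [splitGauss, Prod.ext_iff]; omega⟩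
    · exact ⟨(1, (2 * (m - 1) + n) / 5, (2 * n - (m - 1)) / 5), by
        simp only [splitGauss, Prod.ext_iff]; omega⟩
    · exact ⟨(4, (2 * (-1 - n) + m) / 5, (2 * m - (-1 - n)) / 5), by
        simp only [splitGauss, Prod.ext_iff]; omega⟩
    · exact ⟨(2, (2 * (n - 1) - m) / 5, (-2 * m - (n - 1)) / 5), by
        simp only [splitGauss, Prod.ext_iff]; omega⟩
    · exact ⟨(3, (2 * (-1 - m) - n) / 5, (-2 * n - (-1 - m)) / 5), by
        simp only [splitGauss, Prod.ext_iff]; omega⟩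

theorem splitOddGauss_bijective : Function.Bijective splitOddGauss := by
  constructor
  · rintro ⟨c, a, b⟩ ⟨c', a', b'⟩ h
    fin_cases c <;> fin_cases c' <;> simp [splitOddGauss, Prod.ext_iff] at h ⊢ <;> omega
  · rintro ⟨m, n⟩
    -- Here (2m + 1) + (2n + 1)i has residue 2(m - 2n) - 1, so the multiples of 2 + i have m - 2n ≡
    -- 3.
    have h : (m - 2 * n) % 5 = 0 ∨ (m - 2 * n) % 5 = 1 ∨ (m - 2 * n) % 5 = 2 ∨
      (m - 2 * n) % 5 = 3 ∨ (m - 2 * n) % 5 = 4 := by omega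
    rcases h with h | h | h | h | h
    · exact ⟨(1, (2 * m + n) / 5, (2 * n - m) / 5), by
        simp only [splitOddGauss, Prod.ext_iff]; omega⟩
    · exact ⟨(3, (2 * (-1 - m) + (-1 - n)) / 5, (2 * (-1 - n) - (-1 - m)) / 5), by
        simp only [splitOddGauss, Prod.ext_iff]; omega⟩
    · exact ⟨(4, (2 * (-1 - n) + m) / 5, (2 * m - (-1 - n)) / 5), by
        simp only [splitOddGauss, Prod.ext_iff]; omega⟩
    · exact ⟨(0, (2 * m + (n - 1)) / 5, (2 * (n - 1) - m) / 5), by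
        simp only [splitOddGauss, Prod.ext_iff]; omega⟩
    · exact ⟨(2, (2 * n + (-1 - m)) / 5, (2 * (-1 - m) - n) / 5), by
        simp only [splitOddGauss, Prod.ext_iff]; omega⟩

/-- The multiples of 2 + i give a square again. The four unit classes are rotations of one another
and contribute equally, whence the factor 4. -/
theorem tsum_mul_self_split {e : Fin 5 × ℤ × ℤ → ℤ × ℤ} (he : Function.Bijective e)
    {t f g h : ℤ → ℂ} (κ ν : ℂ) (ht : Summable t) (hf : Summable f) (hg : Summable g)
    (hh : Summable h)
    (h0 : ∀ a b, t (e (0, a, b)).1 * t (e (0, a, b)).2 = κ * (f a * f b))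
    (h1 : ∀ c, c ≠ 0 → ∀ a b, t (e (c, a, b)).1 * t (e (c, a, b)).2 = ν * (g a * h b)) :
    (∑' n, t n) ^ 2 = κ * (∑' n, f n) ^ 2 + 4 * (ν * ((∑' n, g n) * ∑' n, h n)) := by
  rw [pow_two, pow_two, tsum_mul_tsum_of_summable_norm ht.norm ht.norm,
    tsum_mul_tsum_of_summable_norm hf.norm hf.norm, tsum_mul_tsum_of_summable_norm hg.norm hh.norm]
  have hs : Summable fun z : ℤ × ℤ => t z.1 * t z.2 := summable_mul_of_summable_norm ht.norm ht.norm
  let E := Equiv.ofBijective e he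
  have hsE : Summable fun w : Fin 5 × ℤ × ℤ => t (E w).1 * t (E w).2 :=
    (E.summable_iff (f := fun z : ℤ × ℤ => t z.1 * t z.2)).2 hs
  rw [← E.tsum_eq, hsE.tsum_prod, tsum_fintype, Fin.sum_univ_five]
  have k0 : ∑' w : ℤ × ℤ, t (E (0, w)).1 * t (E (0, w)).2 = κ * ∑' z : ℤ × ℤ, f z.1 * f z.2 := by
    rw [← tsum_mul_left]; exact tsum_congr fun w => h0 w.1 w.2
  have k1 : ∀ c : Fin 5, c ≠ 0 → ∑' w : ℤ × ℤ, t (E (c, w)).1 * t (E (c, w)).2 =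
      ν * ∑' z : ℤ × ℤ, g z.1 * h z.2 := fun c hc => by
    rw [← tsum_mul_left]; exact tsum_congr fun w => h1 c hc w.1 w.2
  rw [k0, k1 1 (by decide), k1 2 (by decide), k1 3 (by decide), k1 4 (by decide)]
  ring

/-- The summand is (-1)^(m+n) q^|z|² with z = m + ni. On (2 + i)w the norm is 5|w|²; on 1 + (2 +
i)(a + bi) it is 1 + (5a² + 4a) + (5b² - 2b), so the variables separate. -/
theorem jacobiTheta₂_half_sq {τ : ℂ} (hτ : 0 < τ.im) :
    jacobiTheta₂ (1 / 2) (2 * τ) ^ 2 = jacobiTheta₂ (1 / 2) (10 * τ) ^ 2 +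
      4 * (-cexp (2 * Real.pi * I * τ) *
        (jacobiTheta₂ (1 / 2 + 4 * τ) (10 * τ) * jacobiTheta₂ (1 / 2 - 2 * τ) (10 * τ))) := by
  have h2 : 0 < (2 * τ).im := by simpa using hτ
  have h10 : 0 < (10 * τ).im := by simpa using hτ
  have hq : -cexp (2 * Real.pi * I * τ) = cexp (Real.pi * I + 2 * Real.pi * I * τ) := by
    rw [Complex.exp_add, Complex.exp_pi_mul_I]; ring
  have := tsum_mul_self_split splitGauss_bijective 1 (-cexp (2 * Real.pi * I * τ))
    (t := (jacobiTheta₂_term · (1 / 2) (2 * τ))) (f := (jacobiTheta₂_term · (1 / 2) (10 * τ)))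
    (g := (jacobiTheta₂_term · (1 / 2 + 4 * τ) (10 * τ)))
    (h := (jacobiTheta₂_term · (1 / 2 - 2 * τ) (10 * τ)))
    ((summable_jacobiTheta₂_term_iff _ _).2 h2) ((summable_jacobiTheta₂_term_iff _ _).2 h10)
    ((summable_jacobiTheta₂_term_iff _ _).2 h10) ((summable_jacobiTheta₂_term_iff _ _).2 h10)
    (fun a b => ?_) (fun c hc a b => ?_)
  · rwa [one_mul] at this
  · simp only [splitGauss, jacobiTheta₂_term, one_mul, ← Complex.exp_add]
    -- The witness, here and in the cases below, is half the even difference between the two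
    -- exponents of -1.
    exact Complex.exp_eq_exp_iff_exists_int.2 ⟨a, by push_cast; ring⟩
  · rw [hq]
    fin_cases c
    · exact absurd rfl hc
    all_goals simp only [splitGauss, jacobiTheta₂_term, ← Complex.exp_add]
    · exact Complex.exp_eq_exp_iff_exists_int.2 ⟨a, by push_cast; ring⟩
    · exact Complex.exp_eq_exp_iff_exists_int.2 ⟨-2 * b, by push_cast; ring⟩
    · exact Complex.exp_eq_exp_iff_exists_int.2 ⟨-1 - 2 * a - b, by push_cast; ring⟩
    · exact Complex.exp_eq_exp_iff_exists_int.2 ⟨-1 - a + b, by push_cast; ring⟩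

/-- With z = (2m + 1) + (2n + 1)i the summand is q^((|z|² - 2)/8), and the same division by 2 + i
applies. -/
theorem jacobiTheta₂_odd_sq {τ : ℂ} (hτ : 0 < τ.im) :
    jacobiTheta₂ (τ / 2) τ ^ 2 =
      cexp (2 * Real.pi * I * τ) * jacobiTheta₂ (5 * τ / 2) (5 * τ) ^ 2 +
        4 * (1 * (jacobiTheta₂ (3 * τ / 2) (5 * τ) * jacobiTheta₂ (τ / 2) (5 * τ))) := by
  have h5 : 0 < (5 * τ).im := by simpa using hτ
  refine tsum_mul_self_split splitOddGauss_bijective (cexp (2 * Real.pi * I * τ)) 1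
    (t := (jacobiTheta₂_term · (τ / 2) τ)) (f := (jacobiTheta₂_term · (5 * τ / 2) (5 * τ)))
    (g := (jacobiTheta₂_term · (3 * τ / 2) (5 * τ)))
    (h := (jacobiTheta₂_term · (τ / 2) (5 * τ)))
    ((summable_jacobiTheta₂_term_iff _ _).2 hτ) ((summable_jacobiTheta₂_term_iff _ _).2 h5)
    ((summable_jacobiTheta₂_term_iff _ _).2 h5) ((summable_jacobiTheta₂_term_iff _ _).2 h5)
    (fun a b => ?_) (fun c hc a b => ?_)
  · simp only [splitOddGauss, jacobiTheta₂_term, ← Complex.exp_add]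
    congr 1; push_cast; ring
  · rw [one_mul]
    fin_cases c
    · exact absurd rfl hc
    all_goals
      simp only [splitOddGauss, jacobiTheta₂_term, ← Complex.exp_add]
      congr 1; push_cast; ring

end LevelTwenty

/-! ### The Hauptmodul of level ten in the nome. -/

namespace LevelTwenty

open Filter Topology Finset Complex

/-- Euler's product `∏ (1 - q ^ n)`, `n ≥ 1`. -/
noncomputable def euler (q : ℂ) : ℂ := qPoch q q

theorem euler_pow_ne_zero {q : ℂ} (hq : ‖q‖ < 1) {n : ℕ} (hn : n ≠ 0) : euler (q ^ n) ≠ 0 :=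
  qPoch_self_ne_zero (norm_pow_lt_one hq hn)

theorem norm_cexp_lt_one {τ : ℂ} (hτ : 0 < τ.im) : ‖cexp (2 * Real.pi * I * τ)‖ < 1 := by
  rw [Complex.norm_exp, Real.exp_lt_one_iff]
  simp
  positivity

theorem exists_eq_cexp {q : ℂ} (hq0 : q ≠ 0) (hq : ‖q‖ < 1) :
    ∃ τ : ℂ, 0 < τ.im ∧ cexp (2 * Real.pi * I * τ) = q := by
  refine ⟨Complex.log q / (2 * Real.pi * I), ?_, ?_⟩
  · have h : Complex.log q / (2 * Real.pi * I) =
        -(I * Complex.log q) * ((1 / (2 * Real.pi) : ℝ) : ℂ) := by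
      push_cast
      field_simp
      rw [I_sq]; ring
    rw [h, Complex.im_mul_ofReal]
    simp only [neg_im, I_mul_im, Complex.log_re]
    have := Real.log_neg (norm_pos_iff.2 hq0) hq
    have := neg_pos.2 this
    positivity
  · rw [mul_div_cancel₀ _ two_pi_I_ne_zero, Complex.exp_log hq0]

section theta

variable {τ q : ℂ}

theorem cexp_eq_pow (hq : cexp (2 * Real.pi * I * τ) = q) {w : ℂ} (n : ℕ)
    (h : w = n * (2 * Real.pi * I * τ)) : cexp w = q ^ n := by
  rw [h, Complex.exp_nat_mul, hq]

theorem cexp_eq_neg_pow (hq : cexp (2 * Real.pi * I * τ) = q) {w : ℂ} (n : ℕ)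
    (h : w = Real.pi * I + n * (2 * Real.pi * I * τ)) : cexp w = -q ^ n := by
  rw [h, Complex.exp_add, Complex.exp_nat_mul, hq, Complex.exp_pi_mul_I, neg_one_mul]

theorem cexp_eq_neg_pow' (hq : cexp (2 * Real.pi * I * τ) = q) {w : ℂ} (n : ℕ)
    (h : w = -(Real.pi * I) + n * (2 * Real.pi * I * τ)) : cexp w = -q ^ n := by
  rw [h, Complex.exp_add, Complex.exp_nat_mul, hq, Complex.exp_neg, Complex.exp_pi_mul_I,
    inv_neg, inv_one, neg_one_mul]

theorem theta_neg_eq (hτ : 0 < τ.im) (hq : cexp (2 * Real.pi * I * τ) = q) :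
    jacobiTheta₂ (1 / 2) (2 * τ) = euler q ^ 2 / euler (q ^ 2) := by
  have hn : ‖q‖ < 1 := hq ▸ norm_cexp_lt_one hτ
  have h2 := qPoch_self_ne_zero (norm_pow_lt_one hn two_ne_zero)
  rw [jacobiTheta₂_eq_qPoch (a := -q ^ 1) (b := -q ^ 1) (p := q ^ 2) (by simpa using hτ)
    (cexp_eq_neg_pow hq 1 (by push_cast; ring)) (cexp_eq_neg_pow' hq 1 (by push_cast; ring))
    (by ring), neg_neg, pow_one, qPoch_self_sq hn, euler, euler]
  field_simp

theorem theta_odd_eq (hτ : 0 < τ.im) (hq : cexp (2 * Real.pi * I * τ) = q) :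
    jacobiTheta₂ (τ / 2) τ = 2 * euler (q ^ 2) ^ 2 / euler q := by
  have hn : ‖q‖ < 1 := hq ▸ norm_cexp_lt_one hτ
  have h1 := qPoch_self_ne_zero hn
  -- As b = 1, the factor (-1; q)_∞ equals 2(-q; q)_∞, the source of the 2.
  rw [jacobiTheta₂_eq_qPoch (a := q ^ 1) (b := q ^ 0) (p := q) hτ
    (cexp_eq_pow hq 1 (by push_cast; ring)) (cexp_eq_pow hq 0 (by push_cast; ring))
    (by ring), pow_zero, qPoch_succ (-1) hn, neg_one_mul, pow_one, qPoch_neg_self hn, euler, euler]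
  field_simp
  norm_num

theorem theta_neg_mul_eq (hτ : 0 < τ.im) (hq : cexp (2 * Real.pi * I * τ) = q) :
    jacobiTheta₂ (1 / 2 + 4 * τ) (10 * τ) * jacobiTheta₂ (1 / 2 - 2 * τ) (10 * τ) =
      euler (q ^ 10) ^ 3 * euler q / (euler (q ^ 2) * euler (q ^ 5)) := by
  have hn : ‖q‖ < 1 := hq ▸ norm_cexp_lt_one hτ
  have h2 := qPoch_self_ne_zero (norm_pow_lt_one hn two_ne_zero)
  have h5 := qPoch_self_ne_zero (norm_pow_lt_one hn (show 5 ≠ 0 by norm_num))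
  have h := prod_theta_ten hn
  rw [jacobiTheta₂_eq_qPoch (a := -q ^ 9) (b := -q ^ 1) (p := q ^ 10) (by simpa using hτ)
    (cexp_eq_neg_pow hq 9 (by push_cast; ring)) (cexp_eq_neg_pow' hq 1 (by push_cast; ring))
    (by ring),
    jacobiTheta₂_eq_qPoch (a := -q ^ 3) (b := -q ^ 7) (p := q ^ 10) (by simpa using hτ)
    (cexp_eq_neg_pow hq 3 (by push_cast; ring)) (cexp_eq_neg_pow' hq 7 (by push_cast; ring))
    (by ring)]
  simp only [neg_neg, pow_one, euler]
  calc _ = qPoch (q ^ 10) (q ^ 10) ^ 2 * (qPoch q (q ^ 10) * qPoch (q ^ 3) (q ^ 10) *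
        qPoch (q ^ 7) (q ^ 10) * qPoch (q ^ 9) (q ^ 10)) := by ring
    _ = _ := by rw [h]; field_simp

theorem theta_odd_mul_eq (hτ : 0 < τ.im) (hq : cexp (2 * Real.pi * I * τ) = q) :
    jacobiTheta₂ (3 * τ / 2) (5 * τ) * jacobiTheta₂ (τ / 2) (5 * τ) =
      euler (q ^ 5) ^ 3 * euler (q ^ 2) / (euler q * euler (q ^ 10)) := by
  have hn : ‖q‖ < 1 := hq ▸ norm_cexp_lt_one hτ
  have h1 := qPoch_self_ne_zero hn
  have h10 := qPoch_self_ne_zero (norm_pow_lt_one hn (show 10 ≠ 0 by norm_num))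
  have h := prod_theta_five hn
  rw [jacobiTheta₂_eq_qPoch (a := q ^ 4) (b := q ^ 1) (p := q ^ 5) (by simpa using hτ)
    (cexp_eq_pow hq 4 (by push_cast; ring)) (cexp_eq_pow hq 1 (by push_cast; ring))
    (by ring),
    jacobiTheta₂_eq_qPoch (a := q ^ 3) (b := q ^ 2) (p := q ^ 5) (by simpa using hτ)
    (cexp_eq_pow hq 3 (by push_cast; ring)) (cexp_eq_pow hq 2 (by push_cast; ring))
    (by ring)]
  simp only [pow_one, euler]
  calc _ = qPoch (q ^ 5) (q ^ 5) ^ 2 * (qPoch (-q) (q ^ 5) * qPoch (-q ^ 2) (q ^ 5) *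
        qPoch (-q ^ 3) (q ^ 5) * qPoch (-q ^ 4) (q ^ 5)) := by ring
    _ = _ := by rw [h]; field_simp

end theta

/-- The Hauptmodul of level ten as a function of the nome. -/
noncomputable def hauptmodul (q : ℂ) : ℂ :=
  q * euler (q ^ 2) * euler (q ^ 10) ^ 3 / (euler q ^ 3 * euler (q ^ 5))

section nome

variable {q : ℂ}

/-- This is `jacobiTheta₂_half_sq` divided by its left-hand side. -/
theorem one_add_four_mul_hauptmodul (hq0 : q ≠ 0) (hq : ‖q‖ < 1) :
    1 + 4 * hauptmodul q =
      euler (q ^ 2) ^ 2 * euler (q ^ 5) ^ 4 / (euler q ^ 4 * euler (q ^ 10) ^ 2) := by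
  obtain ⟨τ, hτ, h⟩ := exists_eq_cexp hq0 hq
  have hT := jacobiTheta₂_half_sq hτ
  have h5 : cexp (2 * Real.pi * I * (5 * τ)) = q ^ 5 := cexp_eq_pow h 5 (by push_cast; ring)
  have e5 := theta_neg_eq (τ := 5 * τ) (by simpa using hτ) h5
  rw [show 2 * (5 * τ) = 10 * τ by ring, ← pow_mul] at e5
  rw [theta_neg_eq hτ h, e5, theta_neg_mul_eq hτ h, h] at hT
  norm_num at hT
  have n1 : euler q ≠ 0 := by simpa using euler_pow_ne_zero hq one_ne_zero
  have n2 := euler_pow_ne_zero hq (show 2 ≠ 0 by norm_num)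
  have n5 := euler_pow_ne_zero hq (show 5 ≠ 0 by norm_num)
  have n10 := euler_pow_ne_zero hq (show 10 ≠ 0 by norm_num)
  unfold hauptmodul
  field_simp at hT ⊢
  linear_combination hT

theorem one_add_five_mul_hauptmodul (hq0 : q ≠ 0) (hq : ‖q‖ < 1) :
    1 + 5 * hauptmodul q = euler (q ^ 2) ^ 5 * euler (q ^ 5) / (euler q ^ 5 * euler (q ^ 10)) := by
  obtain ⟨τ, hτ, h⟩ := exists_eq_cexp hq0 hq
  have hB := one_add_four_mul_hauptmodul hq0 hq
  have hT := jacobiTheta₂_odd_sq hτ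
  have h5 : cexp (2 * Real.pi * I * (5 * τ)) = q ^ 5 := cexp_eq_pow h 5 (by push_cast; ring)
  have e5 := theta_odd_eq (τ := 5 * τ) (by simpa using hτ) h5
  rw [← pow_mul] at e5
  rw [theta_odd_eq hτ h, e5, theta_odd_mul_eq hτ h, h] at hT
  norm_num at hT
  have n1 : euler q ≠ 0 := by simpa using euler_pow_ne_zero hq one_ne_zero
  have n2 := euler_pow_ne_zero hq (show 2 ≠ 0 by norm_num)
  have n5 := euler_pow_ne_zero hq (show 5 ≠ 0 by norm_num)
  have n10 := euler_pow_ne_zero hq (show 10 ≠ 0 by norm_num)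
  -- The odd theta identity, rescaled, says that the quotient is x + (1 + 4x).
  have hA : euler (q ^ 2) ^ 5 * euler (q ^ 5) / (euler q ^ 5 * euler (q ^ 10)) =
      hauptmodul q + euler (q ^ 2) ^ 2 * euler (q ^ 5) ^ 4 /
        (euler q ^ 4 * euler (q ^ 10) ^ 2) := by
    unfold hauptmodul
    field_simp at hT ⊢
    linear_combination hT / 4
  rw [hA, ← hB]; ring

theorem euler_neg (hq : ‖q‖ < 1) :
    euler (-q) = euler (q ^ 2) ^ 3 / (euler q * euler (q ^ 4)) := qPoch_neg_neg hq

/-- The modular equation of degree two for the Hauptmodul of level ten. -/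
theorem hauptmodul_sq (hq0 : q ≠ 0) (hq : ‖q‖ < 1) :
    hauptmodul q ^ 2 = 4 * (1 + 5 * hauptmodul q) * hauptmodul (q ^ 2) ^ 2 +
      (6 * hauptmodul q + 1) * hauptmodul (q ^ 2) := by
  have n1 : euler q ≠ 0 := by simpa using euler_pow_ne_zero hq one_ne_zero
  have n2 := euler_pow_ne_zero hq (show 2 ≠ 0 by norm_num)
  have n4 := euler_pow_ne_zero hq (show 4 ≠ 0 by norm_num)
  have n5 := euler_pow_ne_zero hq (show 5 ≠ 0 by norm_num)
  have n10 := euler_pow_ne_zero hq (show 10 ≠ 0 by norm_num)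
  have n20 := euler_pow_ne_zero hq (show 20 ≠ 0 by norm_num)
  have hq2 := norm_pow_lt_one hq two_ne_zero
  have hn0 : -q ≠ 0 := neg_ne_zero.2 hq0
  have hn : ‖-q‖ < 1 := by rwa [norm_neg]
  have s1 := euler_neg hq
  have s5 : euler (-q ^ 5) = euler (q ^ 10) ^ 3 / (euler (q ^ 5) * euler (q ^ 20)) := by
    have := euler_neg (norm_pow_lt_one hq (show 5 ≠ 0 by norm_num))
    simpa only [← pow_mul] using this
  have a1 := one_add_five_mul_hauptmodul hq0 hq
  have a2 := one_add_five_mul_hauptmodul (pow_ne_zero 2 hq0) hq2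
  have a3 := one_add_five_mul_hauptmodul hn0 hn
  have b2 := one_add_four_mul_hauptmodul (pow_ne_zero 2 hq0) hq2
  simp only [← pow_mul] at a2 b2
  norm_num at a2 b2
  rw [Even.neg_pow (by decide : Even 2), Even.neg_pow (by decide : Even 10),
    Odd.neg_pow (by decide : Odd 5), s1, s5] at a3
  -- Replacing q by -q changes only the Euler products at odd powers of q, and `euler_neg` rewrites
  -- those; so this product and the next are functions of q².
  have m1 : hauptmodul q * hauptmodul (-q) =
      -(hauptmodul (q ^ 2) * (1 + 4 * hauptmodul (q ^ 2))) := by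
    rw [b2]
    simp only [hauptmodul, Even.neg_pow (by decide : Even 2), Even.neg_pow (by decide : Even 10),
      Odd.neg_pow (by decide : Odd 5), s1, s5, ← pow_mul]
    norm_num
    field_simp
  have m2 : (1 + 5 * hauptmodul q) * (1 + 5 * hauptmodul (-q)) = 1 + 5 * hauptmodul (q ^ 2) := by
    rw [a1, a2, a3]
    field_simp
  -- The combination cancels every term containing x(-q).
  linear_combination (hauptmodul q / 5) * m2 - (5 * hauptmodul q + 1) * m1

end nome

end LevelTwenty

/-! ### Transformation of eta squared and Atkin-Lehner maps. -/

namespace LevelTwenty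

open Complex hiding eta
open UpperHalfPlane hiding I
open ModularForm

/-- The square of the Dedekind eta function transforms with multiplier `exp (π i k / 6)` under
the integral matrix with rows `(a, b)` and `(c, d)`. -/
def EtaSqTransforms (a b c d k : ℤ) : Prop :=
  ∀ z : ℂ, 0 < z.im → c * z + d ≠ 0 ∧ 0 < ((a * z + b) / (c * z + d)).im ∧
    eta ((a * z + b) / (c * z + d)) ^ 2 =
      cexp (Real.pi * I / 6 * k) * (c * z + d) * eta z ^ 2

theorem eta_eq_euler (z : ℂ) :
    eta z = cexp (2 * Real.pi * I * z / 24) * euler (cexp (2 * Real.pi * I * z)) := by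
  simp only [eta, Function.Periodic.qParam, euler, qPoch, eta_q, pow_succ']
  norm_num

theorem eta_add_int_sq (z : ℂ) (n : ℤ) :
    eta (z + n) ^ 2 = cexp (Real.pi * I / 6 * n) * eta z ^ 2 := by
  have h : cexp (2 * Real.pi * I * (z + n)) = cexp (2 * Real.pi * I * z) :=
    Complex.exp_eq_exp_iff_exists_int.2 ⟨n, by ring⟩
  rw [eta_eq_euler, eta_eq_euler, h, mul_pow, mul_pow, ← mul_assoc, ← Complex.exp_nat_mul,
    ← Complex.exp_nat_mul, ← Complex.exp_add]
  congr 2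
  push_cast
  ring

/-- Squaring removes the branch of the square root, leaving twelfth roots of unity as multipliers.
-/
theorem eta_neg_inv_sq {z : ℂ} (hz : 0 < z.im) : eta (-1 / z) ^ 2 = -I * z * eta z ^ 2 := by
  have h := eta_comp_eq_csqrt_I_inv hz
  have hs : ∀ w : ℂ, sqrt w ^ 2 = w := fun w => by
    simp [sqrt, ← Complex.cpow_nat_mul]
  simp only [Function.comp, Pi.smul_apply, Pi.mul_apply, smul_eq_mul] at h
  rw [h, mul_pow, mul_pow, inv_pow, hs, hs, Complex.inv_I]
  ring

namespace EtaSqTransforms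

theorem one : EtaSqTransforms 1 0 0 1 0 := fun z hz => by simpa using hz

variable {a b c d k : ℤ}

theorem T (h : EtaSqTransforms a b c d k) (n : ℤ) :
    EtaSqTransforms (a + n * c) (b + n * d) c d (k + n) := by
  intro z hz
  obtain ⟨h0, h1, h2⟩ := h z hz
  have e : ((a + n * c : ℤ) * z + (b + n * d : ℤ)) / (c * z + d) =
      (a * z + b) / (c * z + d) + n := by
    push_cast
    field_simp
    ring
  refine ⟨h0, ?_, ?_⟩
  · rw [e]; simpa using h1
  · rw [e, eta_add_int_sq, h2]
    push_cast
    rw [mul_add (Real.pi * I / 6), Complex.exp_add]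
    ring

theorem S (h : EtaSqTransforms a b c d k) : EtaSqTransforms (-c) (-d) a b (k - 3) := by
  intro z hz
  obtain ⟨h0, h1, h2⟩ := h z hz
  set w := (a * z + b) / (c * z + d) with hw
  have w0 : w ≠ 0 := fun h => by simp [h] at h1
  have n0 : a * z + b ≠ 0 := fun h => w0 (by rw [hw, h, zero_div])
  have e : ((-c : ℤ) * z + (-d : ℤ)) / (a * z + b) = -1 / w := by
    push_cast
    rw [hw]
    field_simp
    ring
  refine ⟨n0, ?_, ?_⟩
  · rw [e, neg_div, one_div, Complex.neg_im, Complex.inv_im, neg_div, neg_neg]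
    exact div_pos h1 (Complex.normSq_pos.2 w0)
  · have hw' : w * (c * z + d) = a * z + b := div_mul_cancel₀ _ h0
    have h3 : cexp (Real.pi * I / 6 * (k - 3 : ℤ)) = cexp (Real.pi * I / 6 * k) * -I := by
      push_cast
      rw [← Complex.exp_neg_pi_div_two_mul_I, ← Complex.exp_add]
      congr 1; ring
    rw [e, eta_neg_inv_sq h1, h2, h3, ← hw']
    ring

end EtaSqTransforms

/-- This matrix and the next five express w, 2w, 5w, 10w through 2z, z, 10z, 5z for the two
Atkin-Lehner maps w; each is written as a word in T and S to read off its multiplier. -/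
theorem etaSqTransforms_two_neg_twelve : EtaSqTransforms 2 (-1) 25 (-12) (-25) := by
  simpa using EtaSqTransforms.one.T (-1) |>.S.T (-2) |>.S.T (-13) |>.S

theorem etaSqTransforms_four_neg_six : EtaSqTransforms 4 (-1) 25 (-6) (-29) := by
  simpa using EtaSqTransforms.one.T (-1) |>.S.T (-2) |>.S.T (-2) |>.S.T (-2) |>.S.T (-7) |>.S

theorem etaSqTransforms_two_five_neg_twelve : EtaSqTransforms 2 (-5) 5 (-12) (-17) := by
  simpa using EtaSqTransforms.one.T (-3) |>.S.T (-2) |>.S.T (-3) |>.S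

theorem etaSqTransforms_four_five_neg_six : EtaSqTransforms 4 (-5) 5 (-6) (-25) := by
  simpa using EtaSqTransforms.one.T (-2) |>.S.T (-2) |>.S.T (-2) |>.S.T (-2) |>.S.T (-2) |>.S

theorem etaSqTransforms_one_neg_twentyfour : EtaSqTransforms 1 (-1) 25 (-24) (-38) := by
  -- The additional S² = -1 fixes the sign of the matrix, and with it the sign of the automorphy
  -- factor.
  simpa using EtaSqTransforms.one.T (-1) |>.S.S.S.T (-25) |>.S

theorem etaSqTransforms_one_five_neg_twentyfour : EtaSqTransforms 1 (-5) 5 (-24) (-22) := by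
  simpa using EtaSqTransforms.one.T (-5) |>.S.S.S.T (-5) |>.S

theorem eta_natCast_mul (d : ℕ) (z : ℂ) :
    eta (d * z) = cexp (2 * Real.pi * I * z / 24) ^ d * euler (cexp (2 * Real.pi * I * z) ^ d) := by
  rw [eta_eq_euler, ← Complex.exp_nat_mul, ← Complex.exp_nat_mul]
  congr 3 <;> ring

/-- The Hauptmodul of level ten as an eta quotient on the complex plane. -/
noncomputable def etaX (z : ℂ) : ℂ :=
  eta (2 * z) * eta (10 * z) ^ 3 / (eta z ^ 3 * eta (5 * z))

section etaX

variable {z : ℂ}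

theorem etaX_eq_hauptmodul (z : ℂ) : etaX z = hauptmodul (cexp (2 * Real.pi * I * z)) := by
  have e1 := eta_natCast_mul 1 z
  have e2 := eta_natCast_mul 2 z
  have e5 := eta_natCast_mul 5 z
  have e10 := eta_natCast_mul 10 z
  -- The eta prefactors contribute u^(2 + 30 - 3 - 5) = u^24 = q.
  have hu : cexp (2 * Real.pi * I * z) = cexp (2 * Real.pi * I * z / 24) ^ 24 := by
    rw [← Complex.exp_nat_mul]; congr 1; push_cast; ring
  have hu0 := Complex.exp_ne_zero (2 * Real.pi * I * z / 24)
  push_cast at e1 e2 e5 e10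
  rw [one_mul, pow_one, pow_one] at e1
  rw [etaX, hauptmodul, e1, e2, e5, e10]
  -- Only the leading q is rewritten; those inside the Euler products must stay.
  conv_rhs => rw [show ∀ a b c : ℂ, cexp (2 * Real.pi * I * z) * a * b / c =
    cexp (2 * Real.pi * I * z / 24) ^ 24 * a * b / c from fun a b c => by rw [hu]]
  generalize cexp (2 * Real.pi * I * z / 24) = u at *
  field_simp

theorem one_add_four_mul_etaX (hz : 0 < z.im) :
    1 + 4 * etaX z = eta (2 * z) ^ 2 * eta (5 * z) ^ 4 / (eta z ^ 4 * eta (10 * z) ^ 2) := by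
  have e1 := eta_natCast_mul 1 z
  have e2 := eta_natCast_mul 2 z
  have e5 := eta_natCast_mul 5 z
  have e10 := eta_natCast_mul 10 z
  have hu0 := Complex.exp_ne_zero (2 * Real.pi * I * z / 24)
  push_cast at e1 e2 e5 e10
  rw [one_mul, pow_one, pow_one] at e1
  rw [etaX_eq_hauptmodul, one_add_four_mul_hauptmodul (Complex.exp_ne_zero _)
    (norm_cexp_lt_one hz), e1, e2, e5, e10]
  generalize cexp (2 * Real.pi * I * z / 24) = u at *
  field_simp

theorem one_add_five_mul_etaX (hz : 0 < z.im) :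
    1 + 5 * etaX z = eta (2 * z) ^ 5 * eta (5 * z) / (eta z ^ 5 * eta (10 * z)) := by
  have e1 := eta_natCast_mul 1 z
  have e2 := eta_natCast_mul 2 z
  have e5 := eta_natCast_mul 5 z
  have e10 := eta_natCast_mul 10 z
  have hu0 := Complex.exp_ne_zero (2 * Real.pi * I * z / 24)
  push_cast at e1 e2 e5 e10
  rw [one_mul, pow_one, pow_one] at e1
  rw [etaX_eq_hauptmodul, one_add_five_mul_hauptmodul (Complex.exp_ne_zero _)
    (norm_cexp_lt_one hz), e1, e2, e5, e10]
  generalize cexp (2 * Real.pi * I * z / 24) = u at *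
  field_simp

theorem etaX_sq (hz : 0 < z.im) :
    etaX z ^ 2 = 4 * (1 + 5 * etaX z) * etaX (2 * z) ^ 2 + (6 * etaX z + 1) * etaX (2 * z) := by
  have h := hauptmodul_sq (Complex.exp_ne_zero _) (norm_cexp_lt_one hz)
  rw [etaX_eq_hauptmodul, etaX_eq_hauptmodul,
    show 2 * Real.pi * I * (2 * z) = ((2 : ℕ) : ℂ) * (2 * Real.pi * I * z) by push_cast; ring,
    Complex.exp_nat_mul]
  exact h

theorem eta_ne_zeros (hz : 0 < z.im) :
    eta z ≠ 0 ∧ eta (2 * z) ≠ 0 ∧ eta (5 * z) ≠ 0 ∧ eta (10 * z) ≠ 0 :=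
  ⟨eta_ne_zero hz, eta_ne_zero (by simpa using hz), eta_ne_zero (by simpa using hz),
    eta_ne_zero (by simpa using hz)⟩

theorem one_add_five_mul_etaX_ne_zero (hz : 0 < z.im) : 1 + 5 * etaX z ≠ 0 := by
  obtain ⟨h1, h2, h5, h10⟩ := eta_ne_zeros hz
  rw [one_add_five_mul_etaX hz]
  positivity

theorem etaX_div (hz : 0 < z.im) : etaX z / (1 + 5 * etaX z) =
    eta (10 * z) ^ 4 * eta z ^ 2 / (eta (2 * z) ^ 4 * eta (5 * z) ^ 2) := by
  obtain ⟨h1, h2, h5, h10⟩ := eta_ne_zeros hz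
  rw [one_add_five_mul_etaX hz, etaX]
  field_simp

/-- An Atkin-Lehner transformation of the Hauptmodul, given the transformation of the squares of
the four eta factors. -/
theorem one_add_four_mul_etaX_of_eta_sq {w δ ε : ℂ} (hz : 0 < z.im) (hw : 0 < w.im)
    (hδ : δ ≠ 0) (hε : ε ≠ 0) {k₁ k₂ k₅ k₁₀ m : ℤ}
    (h1 : eta w ^ 2 = cexp (Real.pi * I / 6 * k₁) * δ * eta (2 * z) ^ 2)
    (h2 : eta (2 * w) ^ 2 = cexp (Real.pi * I / 6 * k₂) * ε * eta z ^ 2)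
    (h5 : eta (5 * w) ^ 2 = cexp (Real.pi * I / 6 * k₅) * δ * eta (10 * z) ^ 2)
    (h10 : eta (10 * w) ^ 2 = cexp (Real.pi * I / 6 * k₁₀) * ε * eta (5 * z) ^ 2)
    (hk : k₂ + 2 * k₅ = 2 * k₁ + k₁₀ + 12 * m) :
    1 + 4 * etaX w = etaX z / (1 + 5 * etaX z) := by
  obtain ⟨n1, n2, n5, n10⟩ := eta_ne_zeros hz
  -- The condition `hk` modulo 12 makes the roots of unity cancel; the factors δ and ε cancel by
  -- weight.
  have hc : cexp (Real.pi * I / 6 * k₂) * cexp (Real.pi * I / 6 * k₅) ^ 2 =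
      cexp (Real.pi * I / 6 * k₁) ^ 2 * cexp (Real.pi * I / 6 * k₁₀) := by
    rw [← Complex.exp_nat_mul, ← Complex.exp_nat_mul, ← Complex.exp_add, ← Complex.exp_add]
    refine Complex.exp_eq_exp_iff_exists_int.2 ⟨m, ?_⟩
    have : (k₂ : ℂ) = 2 * k₁ + k₁₀ + 12 * m - 2 * k₅ := by
      rw [eq_sub_iff_add_eq]; exact_mod_cast hk
    rw [this]; push_cast; ring
  rw [one_add_four_mul_etaX hw, etaX_div hz, show eta (5 * w) ^ 4 = (eta (5 * w) ^ 2) ^ 2 by ring,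
    show eta w ^ 4 = (eta w ^ 2) ^ 2 by ring, h1, h2, h5, h10]
  have e1 := Complex.exp_ne_zero (Real.pi * I / 6 * k₁)
  have e10 := Complex.exp_ne_zero (Real.pi * I / 6 * k₁₀)
  generalize cexp (Real.pi * I / 6 * k₁) = c1 at *
  generalize cexp (Real.pi * I / 6 * k₂) = c2 at *
  generalize cexp (Real.pi * I / 6 * k₅) = c5 at *
  generalize cexp (Real.pi * I / 6 * k₁₀) = c10 at *
  rw [div_eq_div_iff (by positivity) (by positivity)]
  linear_combination
    ε * δ ^ 2 * eta z ^ 2 * eta (10 * z) ^ 4 * eta (2 * z) ^ 4 * eta (5 * z) ^ 2 * hc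

theorem one_add_four_mul_etaX_smul₁ (hz : 0 < z.im) :
    1 + 4 * etaX ((4 * z - 1) / (50 * z - 12)) = etaX z / (1 + 5 * etaX z) := by
  obtain ⟨d1, i1, t1⟩ := etaSqTransforms_two_neg_twelve (2 * z) (by simpa using hz)
  obtain ⟨d2, -, t2⟩ := etaSqTransforms_four_neg_six z hz
  obtain ⟨-, -, t5⟩ := etaSqTransforms_two_five_neg_twelve (10 * z) (by simpa using hz)
  obtain ⟨-, -, t10⟩ := etaSqTransforms_four_five_neg_six (5 * z) (by simpa using hz)
  push_cast at d1 i1 t1 d2 t2 t5 t10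
  have s1 : (25 : ℂ) * (2 * z) + -12 = 50 * z - 12 := by ring
  have s2 : (25 : ℂ) * z + -6 = 25 * z - 6 := by ring
  have s5 : (5 : ℂ) * (10 * z) + -12 = 50 * z - 12 := by ring
  have s10 : (5 : ℂ) * (5 * z) + -6 = 25 * z - 6 := by ring
  rw [s1] at d1 i1 t1
  rw [s2] at d2 t2
  rw [s5] at t5
  rw [s10] at t10
  have d3 : 50 * z - 12 = 2 * (25 * z - 6) := by ring
  have r1 : (2 * (2 * z) + -1) / (50 * z - 12) = (4 * z - 1) / (50 * z - 12) := by ring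
  have r2 : (4 * z + -1) / (25 * z - 6) = 2 * ((4 * z - 1) / (50 * z - 12)) := by
    rw [d3]; field_simp; ring
  have r5 : (2 * (10 * z) + -5) / (50 * z - 12) = 5 * ((4 * z - 1) / (50 * z - 12)) := by ring
  have r10 : (4 * (5 * z) + -5) / (25 * z - 6) = 10 * ((4 * z - 1) / (50 * z - 12)) := by
    rw [d3]; field_simp; ring
  rw [r1] at i1 t1
  rw [r2] at t2
  rw [r5] at t5
  rw [r10] at t10
  refine one_add_four_mul_etaX_of_eta_sq (k₁ := -25) (k₂ := -29) (k₅ := -17) (k₁₀ := -25) (m := 1)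
    hz i1 d1 d2 ?_ ?_ ?_ ?_ (by norm_num) <;> push_cast <;> assumption

theorem one_add_four_mul_etaX_smul₂ (hz : 0 < z.im) :
    1 + 4 * etaX ((2 * z - 1) / (50 * z - 24)) = etaX z / (1 + 5 * etaX z) := by
  obtain ⟨d1, i1, t1⟩ := etaSqTransforms_one_neg_twentyfour (2 * z) (by simpa using hz)
  obtain ⟨d2, -, t2⟩ := etaSqTransforms_two_neg_twelve z hz
  obtain ⟨-, -, t5⟩ := etaSqTransforms_one_five_neg_twentyfour (10 * z) (by simpa using hz)
  obtain ⟨-, -, t10⟩ := etaSqTransforms_two_five_neg_twelve (5 * z) (by simpa using hz)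
  push_cast at d1 i1 t1 d2 t2 t5 t10
  have s1 : (25 : ℂ) * (2 * z) + -24 = 50 * z - 24 := by ring
  have s2 : (25 : ℂ) * z + -12 = 25 * z - 12 := by ring
  have s5 : (5 : ℂ) * (10 * z) + -24 = 50 * z - 24 := by ring
  have s10 : (5 : ℂ) * (5 * z) + -12 = 25 * z - 12 := by ring
  rw [s1] at d1 i1 t1
  rw [s2] at d2 t2
  rw [s5] at t5
  rw [s10] at t10
  have d3 : 50 * z - 24 = 2 * (25 * z - 12) := by ring
  have r1 : (1 * (2 * z) + -1) / (50 * z - 24) = (2 * z - 1) / (50 * z - 24) := by ring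
  have r2 : (2 * z + -1) / (25 * z - 12) = 2 * ((2 * z - 1) / (50 * z - 24)) := by
    rw [d3]; field_simp; ring
  have r5 : (1 * (10 * z) + -5) / (50 * z - 24) = 5 * ((2 * z - 1) / (50 * z - 24)) := by ring
  have r10 : (2 * (5 * z) + -5) / (25 * z - 12) = 10 * ((2 * z - 1) / (50 * z - 24)) := by
    rw [d3]; field_simp; ring
  rw [r1] at i1 t1
  rw [r2] at t2
  rw [r5] at t5
  rw [r10] at t10
  refine one_add_four_mul_etaX_of_eta_sq (k₁ := -38) (k₂ := -25) (k₅ := -22) (k₁₀ := -17) (m := 2)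
    hz i1 d1 d2 ?_ ?_ ?_ ?_ (by norm_num) <;> push_cast <;> assumption

end etaX

/-! ### The action of W on x and y. -/

theorem y_eq (τ : ℍ) : y τ = (1 + 5 * etaX τ) * etaX (2 * τ) := by
  obtain ⟨h1, h2, h5, h10⟩ := eta_ne_zeros τ.im_pos
  have h20 : 0 < (2 * (τ : ℂ)).im := by simpa using τ.im_pos
  obtain ⟨-, h4, -, h20⟩ := eta_ne_zeros h20
  rw [one_add_five_mul_etaX τ.im_pos, etaX, y, show 2 * (2 * (τ : ℂ)) = 4 * τ by ring,
    show 10 * (2 * (τ : ℂ)) = 20 * τ by ring, show 5 * (2 * (τ : ℂ)) = 10 * τ by ring]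
  field_simp

/-- Wτ is the image of 2τ under z ↦ (2z - 1)/(50z - 24). -/
theorem x_W_smul (τ : ℍ) :
    x (W • τ) = -(1 + 4 * etaX (2 * τ)) / (4 * (1 + 5 * etaX (2 * τ))) := by
  have h2 : 0 < (2 * (τ : ℂ)).im := by simpa using τ.im_pos
  have h := one_add_four_mul_etaX_smul₂ h2
  have hn := one_add_five_mul_etaX_ne_zero h2
  rw [show (2 * (2 * (τ : ℂ)) - 1) / (50 * (2 * τ) - 24) = (W • τ : ℍ) by
    rw [coe_W_smul]; ring] at h
  change etaX (W • τ : ℍ) = _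
  rw [eq_div_iff (mul_ne_zero (by norm_num) hn)]
  rw [eq_div_iff hn] at h
  linear_combination h

/-- 2Wτ is the image of τ under z ↦ (4z - 1)/(50z - 12), which gives the factor x(2Wτ) of y(Wτ). -/
theorem y_W_smul (τ : ℍ) :
    y (W • τ) = (1 + 4 * etaX τ) / (16 * (1 + 5 * etaX τ) * (1 + 5 * etaX (2 * τ))) := by
  have h2 : 0 < (2 * (τ : ℂ)).im := by simpa using τ.im_pos
  have h := one_add_four_mul_etaX_smul₁ τ.im_pos
  have hn := one_add_five_mul_etaX_ne_zero τ.im_pos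
  have hn2 := one_add_five_mul_etaX_ne_zero h2
  have hd : 50 * (τ : ℂ) - 12 ≠ 0 := fun h => by
    have := congrArg Complex.im h
    simp at this
    exact τ.im_pos.ne' this
  have e : (4 * (τ : ℂ) - 1) / (50 * τ - 12) = 2 * (W • τ : ℍ) := by
    rw [coe_W_smul, show 100 * (τ : ℂ) - 24 = 2 * (50 * τ - 12) by ring]
    field_simp
  have hx : etaX (W • τ : ℍ) = _ := x_W_smul τ
  rw [e, ← eq_sub_iff_add_eq'] at h
  have h' : etaX (2 * (W • τ : ℍ)) = (etaX τ / (1 + 5 * etaX τ) - 1) / 4 := by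
    rw [← h]; ring
  rw [y_eq, hx, h']
  field_simp
  ring

end LevelTwenty

/-! ### Algebra on the curve relating x(τ) and x(2τ). -/

open LevelTwenty UpperHalfPlane in
theorem mainTheorem6 :
    (∀ τ : ℍ, 1 + 5 * x τ ≠ 0) ∧
    ∀ j m n : ℕ, j = 0 ∨ j = 1 → ∀ τ : ℍ,
      f j m n (W • τ) =
        (-1) ^ (m + n) * (4 : ℂ) ^ ((n : ℤ) - 2 * (j : ℤ) - (m : ℤ)) *
          ((1 + 4 * x τ) ^ j * (1 + 10 * x τ + 20 * y τ) ^ j *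
              (1 + 10 * x τ + 20 * x τ ^ 2 + 4 * y τ) ^ m *
              (1 + 5 * x τ + 5 * y τ) ^ n /
            (1 + 5 * x τ) ^ (3 * j + 2 * m + n)) := by
  refine ⟨fun τ => one_add_five_mul_etaX_ne_zero τ.im_pos, fun j m n _ τ => ?_⟩
  have h2 : 0 < (2 * (τ : ℂ)).im := by simpa using τ.im_pos
  have hc := etaX_sq τ.im_pos
  have hu := one_add_five_mul_etaX_ne_zero τ.im_pos
  have hv := one_add_five_mul_etaX_ne_zero h2
  rw [f, x_W_smul, y_W_smul, y_eq, show x τ = etaX τ from rfl]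
  generalize etaX τ = X at *
  generalize etaX (2 * τ) = t at *
  -- This and `e2` are where the modular equation enters; the remaining steps are rational
  -- identities in X and t.
  have e1 : 1 + 10 * X + 20 * ((1 + 5 * X) * t) = (1 + 5 * X) ^ 2 / (1 + 5 * t) := by
    rw [eq_div_iff hv]
    linear_combination -25 * hc
  have e2 : 1 + 10 * X + 20 * X ^ 2 + 4 * ((1 + 5 * X) * t) =
      (1 + 5 * X) ^ 2 * (1 + 4 * t) / (1 + 5 * t) := by
    rw [eq_div_iff hv]
    linear_combination -5 * hc
  have k1 : (1 + 4 * X) / (16 * (1 + 5 * X) * (1 + 5 * t)) =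
      (4 : ℂ)⁻¹ ^ 2 * ((1 + 4 * X) * (1 + 10 * X + 20 * ((1 + 5 * X) * t)) / (1 + 5 * X) ^ 3) := by
    rw [e1]
    field_simp
    ring
  have k2 : -(1 + 4 * t) / (4 * (1 + 5 * t)) =
      -(4 : ℂ)⁻¹ * ((1 + 10 * X + 20 * X ^ 2 + 4 * ((1 + 5 * X) * t)) / (1 + 5 * X) ^ 2) := by
    rw [e2]
    field_simp
  -- The constants collapse to 1 + 5x(Wτ) = -1/(4(1 + 5t)), whose inverse produces (-4)^n.
  have k3 : (1 + 5 * (-(1 + 4 * t) / (4 * (1 + 5 * t))))⁻¹ =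
      -4 * ((1 + 5 * X + 5 * ((1 + 5 * X) * t)) / (1 + 5 * X)) := by
    have : 1 + 5 * (-(1 + 4 * t) / (4 * (1 + 5 * t))) = -(4 * (1 + 5 * t))⁻¹ := by
      field_simp; ring
    rw [this, inv_neg, inv_inv]
    field_simp
  have k4 : (4 : ℂ) ^ ((n : ℤ) - 2 * (j : ℤ) - (m : ℤ)) =
      4 ^ n * ((4 : ℂ)⁻¹ ^ 2) ^ j * (4 : ℂ)⁻¹ ^ m := by
    rw [zpow_sub₀ (by norm_num), zpow_sub₀ (by norm_num), zpow_natCast, zpow_natCast, zpow_mul,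
      zpow_natCast, div_eq_mul_inv, div_eq_mul_inv, inv_pow, inv_pow, inv_pow]
    norm_cast
  rw [div_eq_mul_inv (_ ^ m), ← inv_pow, k1, k3, k2, k4]
  generalize 1 + 10 * X + 20 * ((1 + 5 * X) * t) = A
  generalize 1 + 10 * X + 20 * X ^ 2 + 4 * ((1 + 5 * X) * t) = B
  generalize 1 + 5 * X + 5 * ((1 + 5 * X) * t) = C
  generalize 1 + 4 * X = D
  generalize 1 + 5 * X = u
  simp only [mul_pow, div_pow, neg_pow (4 : ℂ)⁻¹ m, neg_pow (4 : ℂ) n, pow_add, pow_mul]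
  ring
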